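/- Let $d\ge 1$ be an integer, $\varepsilon>0$, $\delta\ge 0$. Let $\mathcal X$ be a set, let $\mathcal X^*=\bigcup_{n\ge 0}\mathcal X^n$ be the set of datasets, and call two datasets neighboring if they have the same size and differ in at most one entry. A mechanism $\mathcal M$ assigns to each dataset a random output; it is $(\varepsilon,\delta)$-DP if $\mathbb P[\mathcal M(D)\in S]\le e^{\varepsilon}\,\mathbb P[\mathcal M(D')\in S]+\delta$ for all neighboring $D,D'$ and all measurable sets $S$ of outputs. Let $\mathsf{BinMap}:[2^d]\to\{0,1\}^d$ be a bijection (for instance a binary representation), where $[2^d]=\{1,\dots,2^d\}$, and let $\widetilde M:\mathcal X^*\to[2^d]$ be an $(\varepsilon,\delta)$-DP mechanism. On a dataset $D$, let $u_{\mathrm{apx}}$ be the output of $\widetilde M(D)$, and obtain $u_{\mathrm{pure}}$ from it by the following algorithm, all of whose random choices are independent of each other and of $u_{\mathrm{apx}}$. 1. Put $z_{\mathrm{bin}}=\mathsf{BinMap}(u_{\mathrm{apx}})\in\{0,1\}^d\subseteq[0,1]^d$. 2. Put $\omega=2^{-d}$ and $\Delta=2R\,\bigl(\tfrac{\delta}{2\omega}\bigr)^{1/d}$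 with $R=\tfrac d2$, the $\ell_1$-radius of the cube $[0,1]^d$. 3. With probability $1-\omega$ put $x=z_{\mathrm{bin}}$; otherwise sample $x$ from the uniform distribution on $[0,1]^d$. 4. Put $z_{\mathrm{pure}}=x+y$, where the coordinates of $y\in\mathbb R^d$ are i.i.d. Laplace variables with mean $0$ and scale $2\Delta/\varepsilon$ (for $\delta=0$ the scale is $0$ and $y=0$). 5. Put $z_{\mathrm{round}}=\bigl(\mathbf 1((z_{\mathrm{pure}})_i\ge \tfrac12)\bigr)_{i=1}^d$ and output $u_{\mathrm{pure}}=\mathsf{BinMap}^{-1}(z_{\mathrm{round}})$. If $\delta<\dfrac{\varepsilon^d}{(2d)^{3d}}$, then the mechanism $D\mapsto u_{\mathrm{pure}}$ is $(2\varepsilon,0)$-DP, and for every dataset $D$ $$\mathbb P[u_{\mathrm{apx}}=u_{\mathrm{pure}}]>1-2^{-d}-\frac d2 e^{-d}.$$ -/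

import Mathlib

open MeasureTheory

namespace Purification

/-- The space `𝒳^* = ⋃ₙ 𝒳ⁿ` of finite datasets with entries in `X`. -/
abbrev Dataset (X : Type*) := Σ n : ℕ, (Fin n → X)

/-- Neighboring datasets: they have the same size and differ in at most one entry. -/
def Neighbor {X : Type*} (D D' : Dataset X) : Prop :=
  ∃ (n : ℕ) (x y : Fin n → X), D = ⟨n, x⟩ ∧ D' = ⟨n, y⟩ ∧ {i | x i ≠ y i}.Subsingleton

/-- `M`, which sends a dataset to the law of its random output, is an `(ε, δ)`-differentially
private mechanism. -/
structure IsDP {X Y : Type*} [MeasurableSpace Y] (M : Dataset X → Measure Y) (ε δ : ℝ) :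
    Prop where
  isProbabilityMeasure : ∀ D, IsProbabilityMeasure (M D)
  bound : ∀ D D', Neighbor D D' → ∀ S : Set Y, MeasurableSet S →
    (M D).real S ≤ Real.exp ε * (M D').real S + δ

/-- The centered Laplace distribution of scale `b`: density `x ↦ exp (-|x| / b) / (2 * b)` if
`0 < b`, and no noise (the point mass at `0`) for the degenerate scale `b = 0`. -/
noncomputable def laplace (b : ℝ) : Measure ℝ :=
  if 0 < b then volume.withDensity (fun x => ENNReal.ofReal (Real.exp (-|x| / b) / (2 * b)))
  else Measure.dirac 0

/-- `Laplace^{⊗ d}(b)`: `d` independent Laplace variables of scale `b`. -/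
noncomputable def laplaceVec (d : ℕ) (b : ℝ) : Measure (Fin d → ℝ) :=
  Measure.pi fun _ => laplace b

/-- The uniform distribution on a set `Θ ⊆ ℝ^d` (of positive finite volume). -/
noncomputable def unif {d : ℕ} (Θ : Set (Fin d → ℝ)) : Measure (Fin d → ℝ) :=
  (volume Θ)⁻¹ • volume.restrict Θ

/-- The bound `Δ = 2 d^{1 - 1/q} R (δ / (2ω))^{1/d}` to which the noise is calibrated. -/
noncomputable def noiseBound (d : ℕ) (q R δ ω : ℝ) : ℝ :=
  2 * (d : ℝ) ^ (1 - 1 / q) * R * (δ / (2 * ω)) ^ (1 / (d : ℝ))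

/-- Uniform mixing: the law of the point that equals `x` with probability `1 - ω` and is
otherwise sampled from `Unif(Θ)`. -/
noncomputable def mix {d : ℕ} (Θ : Set (Fin d → ℝ)) (ω : ℝ) (x : Fin d → ℝ) :
    Measure (Fin d → ℝ) :=
  ENNReal.ofReal (1 - ω) • Measure.dirac x + ENNReal.ofReal ω • unif Θ

/-- The continuous purification algorithm `𝒜_pure(x, Θ, ε', δ, ω)`, with `Θ` of `ℓ_q`-radius `R`:
the law of its output on input `x`. It mixes with the uniform distribution on `Θ` and then adds
independent Laplace noise of scale `2Δ/ε'` to each coordinate. -/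
noncomputable def aPure {d : ℕ} (q R : ℝ) (x : Fin d → ℝ) (Θ : Set (Fin d → ℝ))
    (ε' δ ω : ℝ) : Measure (Fin d → ℝ) :=
  Measure.conv (mix Θ ω x) (laplaceVec d (2 * noiseBound d q R δ ω / ε'))

/-- The finite output space `[2^d] = {1, …, 2^d}`. -/
abbrev Index (d : ℕ) := Set.Icc (1 : ℕ) (2 ^ d)

/-- The inclusion of `{0,1}^d` in `ℝ^d`. -/
def embed {d : ℕ} (z : Fin d → Fin 2) : Fin d → ℝ := fun i => ((z i : ℕ) : ℝ)

/-- Coordinatewise rounding `x ↦ (𝟏(xᵢ ≥ 1/2))ᵢ` from `ℝ^d` to `{0,1}^d`. -/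
noncomputable def round {d : ℕ} (x : Fin d → ℝ) : Fin d → Fin 2 :=
  fun i => if 1 / 2 ≤ x i then 1 else 0

/-- Binary embedding purification: the law of the output `u_pure` on input `u_apx = u`.
The index is encoded by the bijection `binMap`, purified on the cube `Θ = [0,1]^d` with `ε' = ε`
and `ω = 2^{-d}`, rounded coordinatewise and decoded. The cube is contained in the `ℓ_1`-ball of
radius `d/2` around its center, so that `q = 1` and `R = d/2`. -/
noncomputable def aPureDiscrete {d : ℕ} (binMap : Index d ≃ (Fin d → Fin 2)) (ε δ : ℝ)
    (u : Index d) : Measure (Index d) :=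
  (aPure 1 ((d : ℝ) / 2) (embed (binMap u)) (Set.Icc 0 1) ε δ ((2 : ℝ) ^ d)⁻¹).map
    fun z => binMap.symm (round z)

/-- The purified mechanism: the law of `u_pure`, where `u_apx` is the output of `M`. -/
noncomputable def purify {X : Type*} {d : ℕ} (binMap : Index d ≃ (Fin d → Fin 2)) (ε δ : ℝ)
    (M : Dataset X → Measure (Index d)) (D : Dataset X) : Measure (Index d) :=
  (M D).bind (aPureDiscrete binMap ε δ)

/-- The joint law of `(u_apx, u_pure)` on the dataset `D`. -/
noncomputable def jointLaw {X : Type*} {d : ℕ} (binMap : Index d ≃ (Fin d → Fin 2)) (ε δ : ℝ)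
    (M : Dataset X → Measure (Index d)) (D : Dataset X) : Measure (Index d × Index d) :=
  (M D).bind fun u => (aPureDiscrete binMap ε δ u).map fun v => (u, v)

end Purification

/-! Privacy comes from the uniform branch alone. With probability `ω = 2⁻ᵈ` the point is uniform on
the cube, and then every bit vector is output with probability at least `4⁻ᵈ`
(`quarter_pow_le_conv_unif`). So each nonempty event has a data-independent mass of at least `8⁻ᵈ`,
and the additive `δ`, being at most `(exp (2ε) - 1) * 8⁻ᵈ` (`delta_le_exp_sub_one_mul`), is absorbed
by raising the factor from `exp ε` to `exp (2ε)`. Of the noise, only the bound `1/2` on the mass of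
each closed half-line at `0` enters here.

Utility: the bound on `δ` makes the noise scale at most `1/(2d)` (`noiseScale_mul_le`), so each bit
flips with probability at most `exp (-d) / 2`. Bernoulli's inequality handles all `d` bits
(`one_sub_le_conv_dirac_embed`). -/

namespace Purification

/-! ### Tails of the Laplace distribution -/

section Laplace

open Set Real

theorem laplace_zero : laplace 0 = Measure.dirac 0 := by
  simp [laplace]

theorem laplace_Ici {b c : ℝ} (hb : 0 < b) (hc : 0 ≤ c) :
    laplace b (Ici c) = ENNReal.ofReal (exp (-c / b) / 2) := by
  have hb' : -b⁻¹ < 0 := by simpa using hb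
  rw [laplace, if_pos hb, withDensity_apply _ measurableSet_Ici,
    setLIntegral_congr Ioi_ae_eq_Ici.symm,
    setLIntegral_congr_fun (g := fun x => ENNReal.ofReal (exp (-b⁻¹ * x) / (2 * b)))
      measurableSet_Ioi,
    ← ofReal_integral_eq_lintegral_ofReal ((integrableOn_exp_mul_Ioi hb' c).div_const _)
      (ae_of_all _ fun x => by positivity),
    integral_div, integral_exp_mul_Ioi hb' c]
  · congr 1
    field_simp
  · intro x hx
    have hx : c < x := hx
    simp only [abs_of_nonneg (hc.trans hx.le)]
    congr 3
    field_simp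

theorem laplace_Iic {b c : ℝ} (hb : 0 < b) (hc : c ≤ 0) :
    laplace b (Iic c) = ENNReal.ofReal (exp (c / b) / 2) := by
  have hb' : 0 < b⁻¹ := by simpa using hb
  rw [laplace, if_pos hb, withDensity_apply _ measurableSet_Iic,
    setLIntegral_congr_fun (g := fun x => ENNReal.ofReal (exp (b⁻¹ * x) / (2 * b)))
      measurableSet_Iic,
    ← ofReal_integral_eq_lintegral_ofReal ((integrableOn_exp_mul_Iic hb' c).div_const _)
      (ae_of_all _ fun x => by positivity),
    integral_div, integral_exp_mul_Iic hb' c]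
  · congr 1
    field_simp
  · intro x hx
    have hx : x ≤ c := hx
    simp only [abs_of_nonpos (hx.trans hc)]
    congr 3
    field_simp

instance isProbabilityMeasure_laplace (b : ℝ) : IsProbabilityMeasure (laplace b) := by
  by_cases hb : 0 < b
  · have hna : NullSingletonClass (laplace b) := by
      rw [laplace, if_pos hb]
      infer_instance
    constructor
    rw [← Iic_union_Ioi (a := (0 : ℝ)), measure_union (Iic_disjoint_Ioi le_rfl) measurableSet_Ioi,
      measure_congr (Ioi_ae_eq_Ici (μ := laplace b)), laplace_Iic hb le_rfl, laplace_Ici hb le_rfl,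
      ← ENNReal.ofReal_add (by positivity) (by positivity)]
    norm_num
  · rw [laplace, if_neg hb]
    infer_instance

instance isProbabilityMeasure_laplaceVec (d : ℕ) (b : ℝ) :
    IsProbabilityMeasure (laplaceVec d b) := by
  unfold laplaceVec
  infer_instance

/-- The half-line is closed, so the atom at `0` counts when `b = 0`. -/
theorem half_le_laplace_Ici_zero {b : ℝ} (hb : 0 ≤ b) : 1 / 2 ≤ (laplace b).real (Ici 0) := by
  rcases hb.eq_or_lt with rfl | hb
  · simp [laplace_zero, measureReal_def]
    norm_num
  · rw [measureReal_def, laplace_Ici hb le_rfl, ENNReal.toReal_ofReal (by positivity)]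
    simp

theorem half_le_laplace_Iic_zero {b : ℝ} (hb : 0 ≤ b) : 1 / 2 ≤ (laplace b).real (Iic 0) := by
  rcases hb.eq_or_lt with rfl | hb
  · simp [laplace_zero, measureReal_def]
    norm_num
  · rw [measureReal_def, laplace_Iic hb le_rfl, ENNReal.toReal_ofReal (by positivity)]
    simp

/-- Writing `b * t ≤ c` rather than `t ≤ c / b` keeps the degenerate scale `b = 0` meaningful. -/
theorem laplace_real_Ici_le {b c t : ℝ} (hb : 0 ≤ b) (hc : 0 < c) (h : b * t ≤ c) :
    (laplace b).real (Ici c) ≤ exp (-t) / 2 := by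
  rcases hb.eq_or_lt with rfl | hb
  · rw [laplace_zero, measureReal_def, Measure.dirac_apply' _ measurableSet_Ici]
    simp [hc]
    positivity
  · rw [measureReal_def, laplace_Ici hb hc.le, ENNReal.toReal_ofReal (by positivity)]
    gcongr
    rw [neg_div, neg_le_neg_iff, le_div_iff₀ hb]
    linarith

theorem laplace_real_Iic_neg_le {b c t : ℝ} (hb : 0 ≤ b) (hc : 0 < c) (h : b * t ≤ c) :
    (laplace b).real (Iic (-c)) ≤ exp (-t) / 2 := by
  rcases hb.eq_or_lt with rfl | hb
  · rw [laplace_zero, measureReal_def, Measure.dirac_apply' _ measurableSet_Iic]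
    simp [hc]
    positivity
  · rw [measureReal_def, laplace_Iic hb (by linarith), ENNReal.toReal_ofReal (by positivity)]
    gcongr
    rw [neg_div, neg_le_neg_iff, le_div_iff₀ hb]
    linarith

theorem pow_le_laplaceVec_real_pi {d : ℕ} {b p : ℝ} (hp : 0 ≤ p) (s : Fin d → Set ℝ)
    (h : ∀ i, p ≤ (laplace b).real (s i)) : p ^ d ≤ (laplaceVec d b).real (univ.pi s) := by
  rw [measureReal_def, laplaceVec, Measure.pi_pi, ENNReal.toReal_prod]
  calc p ^ d = ∏ _i : Fin d, p := by simp
    _ ≤ _ := Finset.prod_le_prod (fun _ _ => hp) fun i _ => h i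

end Laplace

/-! ### Rounding after noise: uniform points and vertices of the cube -/

section Rounding

open Set

theorem measurable_round {d : ℕ} : Measurable (round : (Fin d → ℝ) → Fin d → Fin 2) := by
  refine measurable_pi_lambda _ fun i => ?_
  exact Measurable.ite (measurableSet_le measurable_const (measurable_pi_apply i))
    measurable_const measurable_const

theorem volume_cube (d : ℕ) : volume (Icc (0 : Fin d → ℝ) 1) = 1 := by
  simp [Real.volume_Icc_pi]

theorem unif_cube (d : ℕ) :
    unif (Icc (0 : Fin d → ℝ) 1) = volume.restrict (Icc (0 : Fin d → ℝ) 1) := by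
  simp [unif, volume_cube]

instance isProbabilityMeasure_unif_cube (d : ℕ) :
    IsProbabilityMeasure (unif (Icc (0 : Fin d → ℝ) 1)) := by
  rw [unif_cube]
  exact ⟨by simp [volume_cube]⟩

/-- The part of `[0,1]` that rounds to the bit `v`. -/
def roundCell (v : Fin 2) : Set ℝ := if v = 1 then Icc (1 / 2) 1 else Ico 0 (1 / 2)

/-- The half-line of noise values that push a point towards the bit `v`. -/
def noiseCell (v : Fin 2) : Set ℝ := if v = 1 then Ici 0 else Iic 0

/-- The noise values that do not flip the bit `v`. -/
noncomputable def keepCell (v : Fin 2) : Set ℝ :=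
  if v = 1 then (Iic (-(1 / 2)))ᶜ else (Ici (1 / 2))ᶜ

theorem unif_cube_real_pi_roundCell {d : ℕ} (v : Fin d → Fin 2) :
    (unif (Icc (0 : Fin d → ℝ) 1)).real (univ.pi fun i => roundCell (v i)) = (1 / 2) ^ d := by
  have hsub : (univ.pi fun i => roundCell (v i)) ⊆ Icc (0 : Fin d → ℝ) 1 := by
    intro x hx
    have h : ∀ i, 0 ≤ x i ∧ x i ≤ 1 := by
      intro i
      have := hx i (mem_univ i)
      simp only [roundCell] at this
      split_ifs at this
      · exact ⟨by linarith [this.1], this.2⟩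
      · exact ⟨this.1, by linarith [this.2]⟩
    exact ⟨fun i => (h i).1, fun i => (h i).2⟩
  rw [unif_cube, measureReal_def, Measure.restrict_eq_self _ hsub, volume_pi_pi,
    ENNReal.toReal_prod]
  have : ∀ i, (volume (roundCell (v i))).toReal = 1 / 2 := by
    intro i
    unfold roundCell
    split_ifs
    · rw [Real.volume_Icc, ENNReal.toReal_ofReal (by norm_num)]; norm_num
    · rw [Real.volume_Ico, ENNReal.toReal_ofReal (by norm_num)]; norm_num
  simp [this]

theorem round_add_of_mem {d : ℕ} {v : Fin d → Fin 2} {x y : Fin d → ℝ}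
    (hx : x ∈ univ.pi fun i => roundCell (v i)) (hy : y ∈ univ.pi fun i => noiseCell (v i)) :
    round (x + y) = v := by
  funext i
  have hxi := hx i (mem_univ i)
  have hyi := hy i (mem_univ i)
  simp only [roundCell, noiseCell] at hxi hyi
  simp only [round, Pi.add_apply]
  split_ifs at hxi hyi with h
  · rw [h, if_pos (add_zero (1 / 2 : ℝ) ▸ add_le_add hxi.1 hyi)]
  · rw [if_neg (by have h1 := hxi.2; have h2 : y i ≤ 0 := hyi; linarith)]
    omega

theorem round_embed_add_of_mem {d : ℕ} {v : Fin d → Fin 2} {y : Fin d → ℝ}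
    (hy : y ∈ univ.pi fun i => keepCell (v i)) : round (embed v + y) = v := by
  funext i
  have hyi := hy i (mem_univ i)
  simp only [keepCell] at hyi
  simp only [round, Pi.add_apply, embed]
  split_ifs at hyi with h
  · have h2 : -(1 / 2) < y i := by simpa using hyi
    simp only [h]
    exact if_pos (by norm_num; linarith)
  · have h2 : y i < 1 / 2 := by simpa using hyi
    have h0 : v i = 0 := by omega
    simp only [h0]
    exact if_neg (by norm_num; linarith)

/-- If the point is uniform on the cube, every bit vector is an output of probability at least
`4⁻ᵈ`. -/
theorem quarter_pow_le_conv_unif {d : ℕ} {b : ℝ} (hb : 0 ≤ b) (v : Fin d → Fin 2) :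
    (1 / 4 : ℝ) ^ d ≤
      ((unif (Icc (0 : Fin d → ℝ) 1)).conv (laplaceVec d b)).real (round ⁻¹' {v}) := by
  have hsub : (univ.pi fun i => roundCell (v i)) ×ˢ (univ.pi fun i => noiseCell (v i)) ⊆
      (fun x : (Fin d → ℝ) × (Fin d → ℝ) => x.1 + x.2) ⁻¹' (round ⁻¹' {v}) :=
    fun p hp => round_add_of_mem hp.1 hp.2
  rw [Measure.conv, map_measureReal_apply measurable_add
    (measurable_round (measurableSet_singleton v))]
  calc (1 / 4 : ℝ) ^ d = (1 / 2) ^ d * (1 / 2) ^ d := by rw [← mul_pow]; norm_num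
    _ ≤ (unif (Icc (0 : Fin d → ℝ) 1)).real (univ.pi fun i => roundCell (v i)) *
        (laplaceVec d b).real (univ.pi fun i => noiseCell (v i)) := by
      rw [unif_cube_real_pi_roundCell]
      gcongr
      refine pow_le_laplaceVec_real_pi (by norm_num) _ fun i => ?_
      unfold noiseCell
      split_ifs
      · exact half_le_laplace_Ici_zero hb
      · exact half_le_laplace_Iic_zero hb
    _ = _ := (measureReal_prod_prod _ _).symm
    _ ≤ _ := measureReal_mono hsub

theorem one_sub_le_conv_dirac_embed {d : ℕ} {b t : ℝ} (hb : 0 ≤ b) (ht : 0 ≤ t)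
    (h : b * t ≤ 1 / 2) (v : Fin d → Fin 2) :
    1 - d / 2 * Real.exp (-t) ≤
      ((Measure.dirac (embed v)).conv (laplaceVec d b)).real (round ⁻¹' {v}) := by
  have hexp : Real.exp (-t) ≤ 1 := Real.exp_le_one_iff.2 (by linarith)
  rw [Measure.dirac_conv, map_measureReal_apply (by fun_prop)
    (measurable_round (measurableSet_singleton v))]
  calc 1 - d / 2 * Real.exp (-t) = 1 + d * (-(Real.exp (-t) / 2)) := by ring
    -- Bernoulli's inequality gives the union-bound constant from independence.
    _ ≤ (1 + -(Real.exp (-t) / 2)) ^ d := one_add_mul_le_pow (by linarith) d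
    _ ≤ (laplaceVec d b).real (univ.pi fun i => keepCell (v i)) := by
      refine pow_le_laplaceVec_real_pi (by linarith) _ fun i => ?_
      unfold keepCell
      split_ifs
      · rw [probReal_compl_eq_one_sub measurableSet_Iic]
        linarith [laplace_real_Iic_neg_le hb one_half_pos h]
      · rw [probReal_compl_eq_one_sub measurableSet_Ici]
        linarith [laplace_real_Ici_le hb one_half_pos h]
    _ ≤ _ := measureReal_mono fun y hy => round_embed_add_of_mem hy

end Rounding

/-! ### The output law as a mixture -/

section Mixture

open Set

variable {d : ℕ} (binMap : Index d ≃ (Fin d → Fin 2)) (ε δ : ℝ)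

/-- The noise scale of binary embedding purification. -/
noncomputable def noiseScale (d : ℕ) (ε δ : ℝ) : ℝ :=
  2 * noiseBound d 1 ((d : ℝ) / 2) δ ((2 : ℝ) ^ d)⁻¹ / ε

/-- The law of the decoded output when the point before adding noise has law `μ`. -/
noncomputable def decode (μ : Measure (Fin d → ℝ)) : Measure (Index d) :=
  (μ.conv (laplaceVec d (noiseScale d ε δ))).map fun z => binMap.symm (round z)

theorem measurable_symm_round :
    Measurable fun z : Fin d → ℝ => binMap.symm (round z) :=
  (Measurable.of_discrete (f := binMap.symm)).comp measurable_round

instance isProbabilityMeasure_decode (μ : Measure (Fin d → ℝ)) [IsProbabilityMeasure μ] :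
    IsProbabilityMeasure (decode binMap ε δ μ) :=
  Measure.isProbabilityMeasure_map (measurable_symm_round binMap).aemeasurable

theorem decode_real_singleton (μ : Measure (Fin d → ℝ)) (w : Index d) :
    (decode binMap ε δ μ).real {w} =
      (μ.conv (laplaceVec d (noiseScale d ε δ))).real (round ⁻¹' {binMap w}) := by
  rw [decode, map_measureReal_apply (measurable_symm_round binMap) (measurableSet_singleton w)]
  congr 1
  ext z
  simp [Equiv.symm_apply_eq]

/-- Convolution and pushforward are linear in the law of the point. -/
theorem aPureDiscrete_eq (u : Index d) :
    aPureDiscrete binMap ε δ u =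
      ENNReal.ofReal (1 - ((2 : ℝ) ^ d)⁻¹) • decode binMap ε δ (Measure.dirac (embed (binMap u))) +
      ENNReal.ofReal ((2 : ℝ) ^ d)⁻¹ • decode binMap ε δ (unif (Icc 0 1)) := by
  rw [aPureDiscrete, aPure, mix, Measure.add_conv, Measure.conv_smul_left, Measure.conv_smul_left,
    Measure.map_add _ _ (measurable_symm_round binMap), Measure.map_smul, Measure.map_smul]
  rfl

theorem inv_two_pow_le_one (d : ℕ) : ((2 : ℝ) ^ d)⁻¹ ≤ 1 :=
  inv_le_one_of_one_le₀ (one_le_pow₀ (by norm_num))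

theorem aPureDiscrete_real (u : Index d) (S : Set (Index d)) :
    (aPureDiscrete binMap ε δ u).real S =
      (1 - ((2 : ℝ) ^ d)⁻¹) * (decode binMap ε δ (Measure.dirac (embed (binMap u)))).real S +
      ((2 : ℝ) ^ d)⁻¹ * (decode binMap ε δ (unif (Icc 0 1))).real S := by
  have h := inv_two_pow_le_one d
  rw [aPureDiscrete_eq, measureReal_add_apply (by simp [ENNReal.mul_eq_top])
      (by simp [ENNReal.mul_eq_top]), measureReal_ennreal_smul_apply,
    measureReal_ennreal_smul_apply, ENNReal.toReal_ofReal (by linarith),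
    ENNReal.toReal_ofReal (by positivity)]

instance isProbabilityMeasure_aPureDiscrete (u : Index d) :
    IsProbabilityMeasure (aPureDiscrete binMap ε δ u) := by
  have h := inv_two_pow_le_one d
  constructor
  rw [aPureDiscrete_eq]
  simp only [Measure.add_apply, Measure.smul_apply, measure_univ, smul_eq_mul, mul_one]
  rw [← ENNReal.ofReal_add (by linarith) (by positivity)]
  simp

end Mixture

/-! ### Finite output spaces -/

section Finite

theorem bind_real_eq_sum {α β : Type*} [Fintype α] [MeasurableSpace α] [DiscreteMeasurableSpace α]
    [MeasurableSpace β] (μ : Measure α) [IsFiniteMeasure μ] (κ : α → Measure β)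
    [∀ a, IsFiniteMeasure (κ a)] {S : Set β} (hS : MeasurableSet S) :
    (μ.bind κ).real S = ∑ a, μ.real {a} * (κ a).real S := by
  rw [measureReal_def, Measure.bind_apply hS Measurable.of_discrete.aemeasurable,
    lintegral_fintype, ENNReal.toReal_sum fun a _ => by finiteness]
  simp [measureReal_def, mul_comm]

theorem sum_real_singleton_eq_one {α : Type*} [Fintype α] [MeasurableSpace α]
    [MeasurableSingletonClass α] (μ : Measure α) [IsProbabilityMeasure μ] :
    ∑ a, μ.real {a} = 1 := by
  rw [sum_measureReal_singleton]
  simp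

/-- Approximate indistinguishability extends from events to `[0,1]`-valued test functions. -/
theorem sum_mul_le_of_forall_set_le {α : Type*} [Fintype α] [MeasurableSpace α]
    [DiscreteMeasurableSpace α] {P Q : Measure α} [IsFiniteMeasure P] [IsFiniteMeasure Q]
    {c δ : ℝ} (h : ∀ S : Set α, P.real S ≤ c * Q.real S + δ) {f : α → ℝ}
    (hf0 : ∀ a, 0 ≤ f a) (hf1 : ∀ a, f a ≤ 1) :
    ∑ a, P.real {a} * f a ≤ c * ∑ a, Q.real {a} * f a + δ := by
  classical
  -- The event maximizing `P - c * Q`: weights `f ≤ 1` gain no more than its indicator.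
  let T : Finset α := {a | c * Q.real {a} ≤ P.real {a}}
  have hT : ∑ a ∈ T, (P.real {a} - c * Q.real {a}) ≤ δ := by
    have := h T
    rw [← sum_measureReal_singleton, ← sum_measureReal_singleton] at this
    rw [Finset.sum_sub_distrib, ← Finset.mul_sum]
    linarith
  have hle : ∑ a, (P.real {a} - c * Q.real {a}) * f a ≤
      ∑ a ∈ T, (P.real {a} - c * Q.real {a}) := by
    rw [Finset.sum_filter]
    refine Finset.sum_le_sum fun a _ => ?_
    split_ifs with ha
    · exact mul_le_of_le_one_right (by linarith) (hf1 a)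
    · exact mul_nonpos_of_nonpos_of_nonneg (by linarith) (hf0 a)
  have heq : ∑ a, (P.real {a} - c * Q.real {a}) * f a =
      ∑ a, P.real {a} * f a - c * ∑ a, Q.real {a} * f a := by
    rw [Finset.mul_sum, ← Finset.sum_sub_distrib]
    exact Finset.sum_congr rfl fun a _ => by ring
  linarith

end Finite

/-! ### Numerical consequences of the bound on `δ` -/

section Calibration

/-- As `d ≥ 1`, the terms of degree `0` and `d` of the exponential series are distinct. -/
theorem pow_div_factorial_le_exp_sub_one {x : ℝ} (hx : 0 ≤ x) {d : ℕ} (hd : 1 ≤ d) :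
    x ^ d / d.factorial ≤ Real.exp x - 1 := by
  have h := Real.sum_le_exp_of_nonneg hx (d + 1)
  rw [Finset.sum_range_succ] at h
  have h1 : (1 : ℝ) ≤ ∑ i ∈ Finset.range d, x ^ i / i.factorial := by
    refine le_trans (by simp) (Finset.single_le_sum (f := fun i : ℕ => x ^ i / (i.factorial : ℝ))
      (fun i _ => by positivity) (Finset.mem_range.2 hd))
  linarith

theorem pow_div_eq_div_cube_pow (d : ℕ) (ε : ℝ) :
    ε ^ d / (2 * (d : ℝ)) ^ (3 * d) = (ε / (8 * (d : ℝ) ^ 3)) ^ d := by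
  rw [div_pow, pow_mul]
  congr 2
  ring

theorem delta_le_exp_sub_one_mul {d : ℕ} (hd : 1 ≤ d) {ε δ : ℝ} (hε : 0 < ε)
    (hδε : δ < ε ^ d / (2 * (d : ℝ)) ^ (3 * d)) :
    δ ≤ (Real.exp (2 * ε) - 1) * (((2 : ℝ) ^ d)⁻¹ * (1 / 4) ^ d) := by
  have hd1 : (1 : ℝ) ≤ d := by exact_mod_cast hd
  have hfac : (d.factorial : ℝ) ≤ (d : ℝ) ^ d := by exact_mod_cast Nat.factorial_le_pow d
  have h8 : ((2 : ℝ) ^ d)⁻¹ * (1 / 4) ^ d = (1 / 8) ^ d := by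
    rw [← inv_pow, ← mul_pow]; norm_num
  rw [h8]
  calc δ ≤ (ε / (8 * (d : ℝ) ^ 3)) ^ d := by rw [← pow_div_eq_div_cube_pow]; exact hδε.le
    _ ≤ (2 * ε / d * (1 / 8)) ^ d := by
      gcongr
      rw [div_mul_div_comm, div_le_div_iff₀ (by positivity) (by positivity)]
      have : (d : ℝ) ≤ d ^ 3 := le_self_pow₀ hd1 (by norm_num)
      have hd3 : (0 : ℝ) ≤ d ^ 3 := by positivity
      nlinarith
    _ = (2 * ε) ^ d / (d : ℝ) ^ d * (1 / 8) ^ d := by rw [mul_pow, div_pow]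
    _ ≤ (2 * ε) ^ d / d.factorial * (1 / 8) ^ d := by gcongr
    _ ≤ _ := by
      gcongr
      exact pow_div_factorial_le_exp_sub_one (by positivity) hd

/-- For `q = 1` the factor `d ^ (1 - 1/q)` is `1`, and `2R = d`. -/
theorem noiseScale_eq (d : ℕ) (ε δ : ℝ) :
    noiseScale d ε δ = 2 * (d * (δ * 2 ^ d / 2) ^ (1 / (d : ℝ))) / ε := by
  have h : δ / (2 * ((2 : ℝ) ^ d)⁻¹) = δ * 2 ^ d / 2 := by field_simp
  rw [noiseScale, noiseBound, h]
  norm_num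
  ring

theorem noiseScale_nonneg (d : ℕ) {ε δ : ℝ} (hε : 0 < ε) (hδ : 0 ≤ δ) : 0 ≤ noiseScale d ε δ := by
  rw [noiseScale_eq]
  positivity

theorem noiseScale_mul_le {d : ℕ} (hd : 1 ≤ d) {ε δ : ℝ} (hε : 0 < ε) (hδ : 0 ≤ δ)
    (hδε : δ < ε ^ d / (2 * (d : ℝ)) ^ (3 * d)) : noiseScale d ε δ * d ≤ 1 / 2 := by
  have hd1 : (1 : ℝ) ≤ d := by exact_mod_cast hd
  have hroot : (δ * 2 ^ d / 2) ^ (1 / (d : ℝ)) ≤ ε / (4 * (d : ℝ) ^ 2) := by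
    rw [one_div, Real.rpow_inv_le_iff_of_pos (by positivity) (by positivity) (by positivity),
      Real.rpow_natCast]
    rw [pow_div_eq_div_cube_pow] at hδε
    calc δ * 2 ^ d / 2 ≤ δ * 2 ^ d := half_le_self (by positivity)
      _ ≤ (ε / (8 * (d : ℝ) ^ 3)) ^ d * 2 ^ d := by gcongr
      _ = (ε / (4 * (d : ℝ) ^ 3)) ^ d := by
        rw [← mul_pow]
        congr 1
        field_simp
        norm_num
      -- One of the three factors `d` is given up here; `d ^ 2` suffices.
      _ ≤ _ := by
        gcongr
        norm_num
  rw [noiseScale_eq]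
  calc 2 * (d * (δ * 2 ^ d / 2) ^ (1 / (d : ℝ))) / ε * d
      ≤ 2 * (d * (ε / (4 * (d : ℝ) ^ 2))) / ε * d := by gcongr
    _ = 1 / 2 := by field_simp; norm_num

end Calibration

/-! ### Privacy and utility of the purified mechanism -/

section Mechanism

variable {X : Type*} {d : ℕ} {binMap : Index d ≃ (Fin d → Fin 2)} {ε δ : ℝ}
  {M : Dataset X → Measure (Index d)}

/-- The uniform branch ignores `u`, so its contribution is the same for all datasets. -/
theorem purify_real (hM : IsDP M ε δ) (D : Dataset X) (S : Set (Index d)) :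
    (purify binMap ε δ M D).real S =
      (1 - ((2 : ℝ) ^ d)⁻¹) * ∑ u, (M D).real {u} *
        (decode binMap ε δ (Measure.dirac (embed (binMap u)))).real S +
      ((2 : ℝ) ^ d)⁻¹ * (decode binMap ε δ (unif (Set.Icc 0 1))).real S := by
  have := hM.isProbabilityMeasure D
  rw [purify, bind_real_eq_sum _ _ (MeasurableSet.of_discrete (s := S))]
  simp only [aPureDiscrete_real, mul_add]
  rw [Finset.sum_add_distrib, ← Finset.sum_mul, sum_real_singleton_eq_one, one_mul,
    Finset.mul_sum]
  congr 1
  exact Finset.sum_congr rfl fun u _ => by ring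

theorem isDP_purify (hd : 1 ≤ d) (hε : 0 < ε) (hδ : 0 ≤ δ)
    (hδε : δ < ε ^ d / (2 * (d : ℝ)) ^ (3 * d)) (hM : IsDP M ε δ) :
    IsDP (purify binMap ε δ M) (2 * ε) 0 where
  isProbabilityMeasure D := by
    have := hM.isProbabilityMeasure D
    exact isProbabilityMeasure_bind Measurable.of_discrete.aemeasurable
      (ae_of_all _ fun u => inferInstance)
  bound D D' hDD' S _ := by
    have := hM.isProbabilityMeasure D
    have := hM.isProbabilityMeasure D'
    -- The lower bound on the uniform branch needs a point of `S`.
    rcases S.eq_empty_or_nonempty with rfl | ⟨w, hw⟩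
    · simp
    have hω := inv_two_pow_le_one d
    have hω0 : 0 < ((2 : ℝ) ^ d)⁻¹ := by positivity
    rw [purify_real hM, purify_real hM, add_zero]
    set κ : Index d → ℝ := fun u =>
      (decode binMap ε δ (Measure.dirac (embed (binMap u)))).real S
    set U : ℝ := (decode binMap ε δ (unif (Set.Icc 0 1))).real S
    set ω : ℝ := ((2 : ℝ) ^ d)⁻¹
    have hU : (1 / 4 : ℝ) ^ d ≤ U :=
      (quarter_pow_le_conv_unif (noiseScale_nonneg d hε hδ) (binMap w)).trans
        ((decode_real_singleton binMap ε δ _ w).symm.trans_le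
          (measureReal_mono (Set.singleton_subset_iff.2 hw)))
    have hκ : ∑ u, (M D).real {u} * κ u ≤ Real.exp ε * ∑ u, (M D').real {u} * κ u + δ :=
      sum_mul_le_of_forall_set_le (fun T => hM.bound D D' hDD' T MeasurableSet.of_discrete)
        (fun _ => measureReal_nonneg) fun _ => measureReal_le_one
    have hQ : 0 ≤ ∑ u, (M D').real {u} * κ u :=
      Finset.sum_nonneg fun u _ => mul_nonneg measureReal_nonneg measureReal_nonneg
    have hexp : Real.exp ε ≤ Real.exp (2 * ε) := Real.exp_le_exp.2 (by linarith)
    have hexp1 : 0 ≤ Real.exp (2 * ε) - 1 := by linarith [Real.one_lt_exp_iff.2 hε]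
    have hδU : δ ≤ (Real.exp (2 * ε) - 1) * (ω * U) :=
      (delta_le_exp_sub_one_mul hd hε hδε).trans (by gcongr)
    calc (1 - ω) * ∑ u, (M D).real {u} * κ u + ω * U
        ≤ (1 - ω) * (Real.exp (2 * ε) * ∑ u, (M D').real {u} * κ u + δ) + ω * U := by
          gcongr
          exact hκ.trans (by gcongr)
      _ ≤ Real.exp (2 * ε) * ((1 - ω) * ∑ u, (M D').real {u} * κ u) + δ + ω * U := by
          nlinarith
      -- By `hδU`, `δ + ω * U ≤ exp (2ε) * (ω * U)`.
      _ ≤ _ := by linarith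

theorem jointLaw_real_diagonal (hM : IsDP M ε δ) (D : Dataset X) :
    (jointLaw binMap ε δ M D).real {p | p.1 = p.2} =
      ∑ u, (M D).real {u} * (aPureDiscrete binMap ε δ u).real {u} := by
  have := hM.isProbabilityMeasure D
  have (u : Index d) :
      IsFiniteMeasure ((aPureDiscrete binMap ε δ u).map fun v => (u, v)) := inferInstance
  rw [jointLaw, bind_real_eq_sum _ _ MeasurableSet.of_discrete]
  refine Finset.sum_congr rfl fun u _ => ?_
  rw [map_measureReal_apply Measurable.of_discrete MeasurableSet.of_discrete]
  congr 2
  ext v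
  simp [eq_comm]

theorem lt_aPureDiscrete_real_singleton (hd : 1 ≤ d) (hε : 0 < ε) (hδ : 0 ≤ δ)
    (hδε : δ < ε ^ d / (2 * (d : ℝ)) ^ (3 * d)) (u : Index d) :
    1 - ((2 : ℝ) ^ d)⁻¹ - (d : ℝ) / 2 * Real.exp (-(d : ℝ)) <
      (aPureDiscrete binMap ε δ u).real {u} := by
  have hω := inv_two_pow_le_one d
  have hω0 : 0 < ((2 : ℝ) ^ d)⁻¹ := by positivity
  have hp : 0 < (d : ℝ) / 2 * Real.exp (-(d : ℝ)) := by positivity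
  have hkeep := one_sub_le_conv_dirac_embed (noiseScale_nonneg d hε hδ) (Nat.cast_nonneg d)
    (noiseScale_mul_le hd hε hδ hδε) (binMap u)
  rw [← decode_real_singleton] at hkeep
  have hU : 0 ≤ (decode binMap ε δ (unif (Set.Icc 0 1))).real {u} := measureReal_nonneg
  rw [aPureDiscrete_real]
  have h1 := mul_le_mul_of_nonneg_left hkeep (sub_nonneg.2 hω)
  have h2 := mul_nonneg hω0.le hU
  -- Strictness comes from the cross term `ω * p` in `(1 - ω) * (1 - p)`.
  have h3 := mul_pos hω0 hp
  linarith

end Mechanism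

end Purification

theorem theorem2 {X : Type*} (d : ℕ) (hd : 1 ≤ d) (ε δ : ℝ) (hε : 0 < ε) (hδ : 0 ≤ δ)
    (hδε : δ < ε ^ d / (2 * (d : ℝ)) ^ (3 * d))
    (binMap : Purification.Index d ≃ (Fin d → Fin 2))
    (M : Purification.Dataset X → MeasureTheory.Measure (Purification.Index d))
    (hM : Purification.IsDP M ε δ) :
    Purification.IsDP (Purification.purify binMap ε δ M) (2 * ε) 0 ∧
    ∀ D : Purification.Dataset X,
      (Purification.jointLaw binMap ε δ M D).real {p | p.1 = p.2} >
        1 - ((2 : ℝ) ^ d)⁻¹ - (d : ℝ) / 2 * Real.exp (-(d : ℝ)) := by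
  refine ⟨Purification.isDP_purify hd hε hδ hδε hM, fun D => ?_⟩
  have := hM.isProbabilityMeasure D
  rw [gt_iff_lt, Purification.jointLaw_real_diagonal hM]
  set c := 1 - ((2 : ℝ) ^ d)⁻¹ - (d : ℝ) / 2 * Real.exp (-(d : ℝ))
  have hlt (u) : c < (Purification.aPureDiscrete binMap ε δ u).real {u} :=
    Purification.lt_aPureDiscrete_real_singleton hd hε hδ hδε u
  have hsum := Purification.sum_real_singleton_eq_one (M D)
  -- An atom of positive mass keeps the averaged inequality strict.
  obtain ⟨u₀, -, hu₀⟩ : ∃ u ∈ Finset.univ, (M D).real {u} ≠ 0 :=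
    Finset.exists_ne_zero_of_sum_ne_zero (by rw [hsum]; exact one_ne_zero)
  calc c = ∑ u, (M D).real {u} * c := by rw [← Finset.sum_mul, hsum, one_mul]
    _ < _ := Finset.sum_lt_sum
      (fun u _ => mul_le_mul_of_nonneg_left (hlt u).le measureReal_nonneg)
      ⟨u₀, Finset.mem_univ _, mul_lt_mul_of_pos_left (hlt u₀)
        (lt_of_le_of_ne measureReal_nonneg hu₀.symm)⟩
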